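/- Consider finite binary trees (rooted trees in which every vertex has at most one left child and at most one right child, a child being marked as left or right even if it is the only child), possibly empty, in which every edge from a vertex to its right child is colored blue or red. The number of such trees with $n$ vertices is the little Schröder number $s_n$, where $(s_n)_{n\ge 0} = 1, 1, 3, 11, 45, \dots$. Call such a tree hipster if, whenever a vertex has two children, the subtrees consisting of all vertices weakly below these two children are not isomorphic as binary trees with colored right edges (isomorphisms preserve the root, left and right children, and colors). Let $h_n$ be the number of hipster binary trees with colored right edges on $n$ vertices (so $h_0 = 1$ for the empty tree), and let $H(x)=\sum_{n\ge 0} h_n x^n$. Then, as formal power series, $$H(x) = x\left(2H(x)^2 - H(x) - 2H(x^2) + 2\right) + 1,$$ and the exponential growth rate $\lim_{n\to\infty} h_n^{1/n}$ exists and lies in the interval $[5.731821,\ 5.732051]$. -/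

import Mathlib

open Filter Topology

namespace HipsterTree

/-- The two colors available for a right edge. -/
inductive EdgeColor : Type
  | blue : EdgeColor
  | red : EdgeColor

/-- Nonempty binary trees (every child is a left or a right child, also when it is the only
child) in which each edge from a vertex to its right child is colored blue or red. The four
constructors say which children the root has. -/
inductive ColoredTree : Type
  | leaf : ColoredTree
  | onlyLeft (l : ColoredTree) : ColoredTree
  | onlyRight (c : EdgeColor) (r : ColoredTree) : ColoredTree
  | both (l : ColoredTree) (c : EdgeColor) (r : ColoredTree) : ColoredTree

namespace ColoredTree

/-- The number of vertices. -/
def size : ColoredTree → ℕ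
  | leaf => 1
  | onlyLeft l => l.size + 1
  | onlyRight _ r => r.size + 1
  | both l _ r => l.size + r.size + 1

/-- The hipster condition: whenever a vertex has two children, the subtrees hanging from these
two siblings are not isomorphic as binary trees with colored right edges. An isomorphism
respects the root, left children, right children and colors, so isomorphic means equal. -/
def IsHipster : ColoredTree → Prop
  | leaf => True
  | onlyLeft l => l.IsHipster
  | onlyRight _ r => r.IsHipster
  | both l _ r => l ≠ r ∧ l.IsHipster ∧ r.IsHipster

end ColoredTree

/-- The number of vertices of a possibly empty tree; `none` is the empty tree. -/
def size (t : Option ColoredTree) : ℕ := t.elim 0 ColoredTree.size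

/-- The hipster condition for a possibly empty tree; it is vacuous for the empty tree. -/
def IsHipster (t : Option ColoredTree) : Prop := ∀ s ∈ t, s.IsHipster

/-- The number of all binary trees with colored right edges on `n` vertices. -/
noncomputable def treeCount (n : ℕ) : ℕ :=
  {t : Option ColoredTree | size t = n}.ncard

/-- The number `h n` of hipster binary trees with colored right edges on `n` vertices. -/
noncomputable def hipsterCount (n : ℕ) : ℕ :=
  {t : Option ColoredTree | size t = n ∧ IsHipster t}.ncard

/-- The ordinary generating function of `hipsterCount`. -/
noncomputable def hipsterSeries : PowerSeries ℤ :=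
  PowerSeries.mk fun n => (hipsterCount n : ℤ)

/-- `K` is the exponential growth rate of `a`: the roots `(a n) ^ (1 / n)` converge to `K`. -/
def HasGrowthRate (a : ℕ → ℕ) (K : ℝ) : Prop :=
  Tendsto (fun n : ℕ => (a n : ℝ) ^ (1 / (n : ℝ))) atTop (𝓝 K)

end HipsterTree

open Finset.HasAntidiagonal (antidiagonal mem_antidiagonal)

/-! Let T = H - 1 count nonempty hipster trees. Splitting at the root gives T = x(1 + 3T + 2T² -
2T(x²)): three ways to have one child, two colors for two children, and T(x²) removes pairs of equal
siblings (`hipsterSeries_eq`). At x = 1/κ with E = T(x²), a finite value of T solves 2T² - (κ - 3)T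
+ 1 - 2E = 0, so the critical κ has (κ - 3)² = 8(1 - 2E), with double root (κ - 3)/4. At κ =
5.732051 a real root bounds all partial sums (`partialSum_le`); at κ = 5.731821 there is none and
they diverge (`exists_lt_partialSum`). The limit exists by Fekete's lemma, from h_m h_n ≤ h_{m+n+1}
(`hipsterCount_mul_le`). -/

namespace HipsterTree

/-! ### Counting trees by the children of the root -/

namespace ColoredTree

theorem size_pos (t : ColoredTree) : 0 < t.size := by
  cases t <;> simp [size]

theorem finite_size_le (n : ℕ) : {t : ColoredTree | t.size ≤ n}.Finite := by
  induction n with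
  | zero =>
    convert Set.finite_empty (α := ColoredTree)
    ext t
    simpa using (size_pos t).ne'
  | succ n ih =>
    refine ((((((Set.finite_singleton leaf).union (ih.image onlyLeft)).union
      (ih.image (onlyRight .blue))).union (ih.image (onlyRight .red))).union
      ((ih.prod ih).image fun q => both q.1 .blue q.2)).union
      ((ih.prod ih).image fun q => both q.1 .red q.2)).subset ?_
    rintro (_ | l | ⟨_ | _, r⟩ | ⟨l, _ | _, r⟩) ht <;>
      simp [size] at ht ⊢ <;> omega

/-- The trees with `n` vertices that satisfy `p`. -/
def ofSize (p : ColoredTree → Prop) (n : ℕ) : Set ColoredTree := {t | t.size = n ∧ p t}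

theorem finite_ofSize (p : ColoredTree → Prop) (n : ℕ) : (ofSize p n).Finite :=
  (finite_size_le n).subset fun _ ht => ht.1.le

theorem ofSize_zero (p : ColoredTree → Prop) : ofSize p 0 = ∅ := by
  ext t
  simp [ofSize, (size_pos t).ne']

/-- The pairs of trees with `n` vertices altogether that satisfy `p` and, jointly, `q`. -/
def pairsOfSize (p : ColoredTree → Prop) (q : ColoredTree → ColoredTree → Prop) (n : ℕ) :
    Set (ColoredTree × ColoredTree) :=
  {s | s.1.size + s.2.size = n ∧ q s.1 s.2 ∧ p s.1 ∧ p s.2}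

theorem finite_pairsOfSize (p : ColoredTree → Prop) (q : ColoredTree → ColoredTree → Prop)
    (n : ℕ) : (pairsOfSize p q n).Finite :=
  ((finite_size_le n).prod (finite_size_le n)).subset fun _ hs =>
    ⟨le_of_add_le_left hs.1.le, le_of_add_le_right hs.1.le⟩

/-- The relation `q` on siblings lets one decomposition serve all trees (`True`) and hipster trees
(`≠`). -/
theorem ncard_ofSize_succ {p : ColoredTree → Prop} {q : ColoredTree → ColoredTree → Prop}
    (hleaf : p leaf) (hleft : ∀ l, p (onlyLeft l) ↔ p l)
    (hright : ∀ c r, p (onlyRight c r) ↔ p r)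
    (hboth : ∀ l c r, p (both l c r) ↔ q l r ∧ p l ∧ p r) (n : ℕ) :
    (ofSize p (n + 1)).ncard = (if n = 0 then 1 else 0) + 3 * (ofSize p n).ncard
      + 2 * (pairsOfSize p q n).ncard := by
  have hS := finite_ofSize p n
  have hQ := finite_pairsOfSize p q n
  have h0 : ({t | t = leaf ∧ n = 0} : Set ColoredTree).Finite :=
    (Set.finite_singleton leaf).subset fun _ ht => ht.1
  have hc0 : ({t | t = leaf ∧ n = 0} : Set ColoredTree).ncard = if n = 0 then 1 else 0 := by
    split_ifs with h <;> simp [h]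
  have key : ofSize p (n + 1) = ((((({t | t = leaf ∧ n = 0} ∪ onlyLeft '' ofSize p n) ∪
      onlyRight .blue '' ofSize p n) ∪ onlyRight .red '' ofSize p n) ∪
      (fun s => both s.1 .blue s.2) '' pairsOfSize p q n) ∪
      (fun s => both s.1 .red s.2) '' pairsOfSize p q n) := by
    ext t
    rcases t with (_ | l | ⟨_ | _, r⟩ | ⟨l, _ | _, r⟩) <;>
      simp [ofSize, pairsOfSize, size, hleaf, hleft, hright, hboth, eq_comm]
  have b1 : ∀ c, Function.Injective (onlyRight c) := fun c _ _ h => by simpa using h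
  have b2 : ∀ c, Function.Injective (fun s : ColoredTree × ColoredTree => both s.1 c s.2) :=
    fun c s t h => by simpa [Prod.ext_iff] using h
  have f1 := h0.union (hS.image onlyLeft)
  have f2 := f1.union (hS.image (onlyRight .blue))
  have f3 := f2.union (hS.image (onlyRight .red))
  have f4 := f3.union (hQ.image fun s => both s.1 .blue s.2)
  have d1 : Disjoint {t | t = leaf ∧ n = 0} (onlyLeft '' ofSize p n) := by
    rw [Set.disjoint_left]
    rintro _ ⟨rfl, -⟩ ⟨_, _, h⟩
    cases h
  rw [key, Set.ncard_union_eq ?_ f4 (hQ.image _), Set.ncard_union_eq ?_ f3 (hQ.image _),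
    Set.ncard_union_eq ?_ f2 (hS.image _), Set.ncard_union_eq ?_ f1 (hS.image _),
    Set.ncard_union_eq d1 h0 (hS.image _), hc0, Set.ncard_image_of_injective _ (b1 _),
    Set.ncard_image_of_injective _ (b1 _), Set.ncard_image_of_injective _ (b2 _),
    Set.ncard_image_of_injective _ (b2 _),
    Set.ncard_image_of_injective _ fun _ _ h => onlyLeft.inj h]
  · ring
  all_goals
    rw [Set.disjoint_right]
    rintro _ ⟨_, _, rfl⟩
    simp

theorem ncard_pairsOfSize_true (p : ColoredTree → Prop) (n : ℕ) :
    (pairsOfSize p (fun _ _ => True) n).ncard =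
      ∑ ij ∈ antidiagonal n, (ofSize p ij.1).ncard * (ofSize p ij.2).ncard := by
  classical
  have key : pairsOfSize p (fun _ _ => True) n = ((antidiagonal n).biUnion fun ij =>
      (finite_ofSize p ij.1).toFinset ×ˢ (finite_ofSize p ij.2).toFinset : Finset _) := by
    ext ⟨l, r⟩
    simp only [pairsOfSize, ofSize, Set.mem_ofPred_eq, Finset.coe_biUnion, Set.mem_iUnion,
      Finset.mem_coe, mem_antidiagonal, Finset.mem_product, Set.Finite.mem_toFinset]
    constructor
    · rintro ⟨h, -, hl, hr⟩
      exact ⟨(l.size, r.size), h, ⟨rfl, hl⟩, rfl, hr⟩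
    · rintro ⟨ij, h, ⟨h1, hl⟩, h2, hr⟩
      exact ⟨by rw [h1, h2, h], trivial, hl, hr⟩
  rw [key, Set.ncard_coe_finset, Finset.card_biUnion]
  · simp [Finset.card_product, Set.ncard_eq_toFinset_card _ (finite_ofSize p _)]
  · rintro ij - kl - hne
    rw [Function.onFun, Finset.disjoint_left]
    rintro ⟨l, r⟩ h1 h2
    simp only [Finset.mem_product, Set.Finite.mem_toFinset, ofSize, Set.mem_ofPred_eq] at h1 h2
    exact hne (Prod.ext (h1.1.1.symm.trans h2.1.1) (h1.2.1.symm.trans h2.2.1))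

/-- The diagonal pairs `(t, t)` correspond to trees of half the size; they are the source of the
term H(x²). -/
theorem ncard_pairsOfSize_ne (p : ColoredTree → Prop) (n : ℕ) :
    (pairsOfSize p (· ≠ ·) n).ncard + (if Even n then (ofSize p (n / 2)).ncard else 0) =
      ∑ ij ∈ antidiagonal n, (ofSize p ij.1).ncard * (ofSize p ij.2).ncard := by
  have hd : (if Even n then (ofSize p (n / 2)).ncard else 0) =
      (pairsOfSize p (· = ·) n).ncard := by
    have hinj : Function.Injective fun t : ColoredTree => (t, t) := fun _ _ h => (Prod.ext_iff.1 h).1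
    split_ifs with h
    · rw [← Set.ncard_image_of_injective _ hinj]
      congr 1
      ext ⟨l, r⟩
      obtain ⟨m, rfl⟩ := h
      simp only [ofSize, pairsOfSize, Set.mem_image, Set.mem_ofPred_eq, Prod.mk.injEq]
      constructor
      · rintro ⟨t, ⟨h1, h2⟩, rfl, rfl⟩
        exact ⟨by omega, rfl, h2, h2⟩
      · rintro ⟨h1, rfl, h2, -⟩
        exact ⟨l, ⟨by omega, h2⟩, rfl, rfl⟩
    · rw [eq_comm, Set.ncard_eq_zero (finite_pairsOfSize _ _ _)]
      ext ⟨l, r⟩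
      simp only [pairsOfSize, Set.mem_ofPred_eq, Set.mem_empty_iff_false, iff_false]
      rintro ⟨h1, rfl, -⟩
      exact h ⟨_, h1.symm⟩
  rw [hd, ← ncard_pairsOfSize_true, ← Set.ncard_union_eq _ (finite_pairsOfSize _ _ _)
    (finite_pairsOfSize _ _ _)]
  · congr 1
    ext s
    simp only [pairsOfSize, Set.mem_union, Set.mem_ofPred_eq]
    tauto
  · rw [Set.disjoint_left]
    exact fun s h1 h2 => h1.2.1 h2.2.1

end ColoredTree

open ColoredTree

/-! ### Possibly empty trees, Schröder numbers and the functional equation -/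

theorem ncard_option_size (p : ColoredTree → Prop) (n : ℕ) :
    {t : Option ColoredTree | size t = n ∧ ∀ s ∈ t, p s}.ncard =
      (if n = 0 then 1 else 0) + (ofSize p n).ncard := by
  split_ifs with h
  · subst h
    have : {t : Option ColoredTree | size t = 0 ∧ ∀ s ∈ t, p s} = {none} := by
      ext (_ | t)
      · simp [size]
      · simp [size, (size_pos t).ne']
    rw [this, ofSize_zero]
    simp
  · rw [zero_add, ← Set.ncard_image_of_injective (ofSize p n) (Option.some_injective _)]
    congr 1
    ext (_ | t)
    · simpa [size] using Ne.symm h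
    · simp [size, ofSize]

/-- The number of nonempty hipster trees with `n` vertices. -/
noncomputable def nonemptyCount (n : ℕ) : ℕ := (ofSize ColoredTree.IsHipster n).ncard

theorem hipsterCount_eq (n : ℕ) :
    hipsterCount n = (if n = 0 then 1 else 0) + nonemptyCount n :=
  ncard_option_size _ n

theorem hipsterCount_zero : hipsterCount 0 = 1 := by
  simp [hipsterCount_eq, nonemptyCount, ofSize_zero]

theorem nonemptyCount_zero : nonemptyCount 0 = 0 := by
  simp [nonemptyCount, ofSize_zero]

theorem nonemptyCount_succ (n : ℕ) :
    nonemptyCount (n + 1) + 2 * (if Even n then nonemptyCount (n / 2) else 0) =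
      (if n = 0 then 1 else 0) + 3 * nonemptyCount n
        + 2 * ∑ ij ∈ antidiagonal n, nonemptyCount ij.1 * nonemptyCount ij.2 := by
  unfold nonemptyCount
  rw [ncard_ofSize_succ (q := (· ≠ ·)) trivial (fun _ => Iff.rfl) (fun _ _ => Iff.rfl)
    (fun _ _ _ => Iff.rfl), ← ncard_pairsOfSize_ne]
  ring

theorem treeCount_eq (n : ℕ) : treeCount n = Nat.smallSchroder (n + 1) := by
  have h1 : ∀ n, treeCount n = (if n = 0 then 1 else 0) + (ofSize (fun _ => True) n).ncard := by
    intro n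
    rw [← ncard_option_size]
    simp [treeCount]
  have h2 : ∀ n, (ofSize (fun _ => True) (n + 1)).ncard = Nat.smallSchroder (n + 2) := by
    intro n
    induction n using Nat.strong_induction_on with
    | _ n ih =>
    rw [ncard_ofSize_succ (q := fun _ _ => True) trivial (fun _ => by simp) (fun _ _ => by simp)
      (fun _ _ _ => by simp), ncard_pairsOfSize_true]
    rcases n with _ | n
    · simp [ofSize_zero, Nat.smallSchroder]
    -- Both end terms of the convolution are split off: they vanish, since no tree here has size 0.
    · rw [Nat.smallSchroder_succ (by omega), ih n (by omega),
        Finset.Nat.sum_antidiagonal_eq_sum_range_succ_mk, Finset.sum_range_succ,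
        Finset.sum_range_succ', ofSize_zero]
      simp only [Nat.succ_ne_zero, if_false, Set.ncard_empty, zero_mul, add_zero, zero_add,
        Nat.sub_self, ofSize_zero, mul_zero]
      congr 2
      refine (Finset.sum_bij (fun i _ => i + 1) ?_ ?_ ?_ ?_)
      · intro i hi
        simp at hi ⊢
        omega
      · intro i _ j _ h
        simpa using h
      · intro i hi
        simp at hi
        exact ⟨i - 1, by simp; omega, by omega⟩
      · intro i hi
        simp at hi
        rw [ih i (by omega), show n + 1 - (i + 1) = (n - i - 1) + 1 by omega,
          ih _ (by omega), show n - i - 1 + 2 = n + 1 + 1 - (i + 1) by omega]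
  rw [h1]
  rcases n with _ | n
  · simp [ofSize_zero]
  · simp [h2]

theorem hipsterSeries_eq :
    hipsterSeries =
      PowerSeries.X *
        (2 * hipsterSeries ^ 2 - hipsterSeries
          - 2 * hipsterSeries.subst (PowerSeries.X ^ 2 : PowerSeries ℤ) + 2) + 1 := by
  set T : PowerSeries ℤ := PowerSeries.mk fun n => (nonemptyCount n : ℤ) with hT
  have hH : hipsterSeries = 1 + T := by
    ext n
    simp [hipsterSeries, hipsterCount_eq, hT, PowerSeries.coeff_one]
  have hsub : hipsterSeries.subst (PowerSeries.X ^ 2 : PowerSeries ℤ)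
      = 1 + PowerSeries.mk fun n => (if Even n then (nonemptyCount (n / 2) : ℤ) else 0) := by
    ext n
    rw [PowerSeries.coeff_subst_X_pow two_ne_zero, hH]
    simp only [even_iff_two_dvd, map_add, PowerSeries.coeff_one, hT, PowerSeries.coeff_mk]
    rcases eq_or_ne n 0 with rfl | hn
    · simp [nonemptyCount_zero]
    · rw [if_neg hn, zero_add]
      split_ifs with hd h2
      · omega
      · simp
      · rfl
  have hrec : T = PowerSeries.X * (1 + 3 * T + 2 * T ^ 2
      - 2 * PowerSeries.mk fun n => (if Even n then (nonemptyCount (n / 2) : ℤ) else 0)) := by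
    ext n
    rcases n with _ | n
    · simp [hT, nonemptyCount_zero]
    · rw [PowerSeries.coeff_succ_X_mul, show (3 : PowerSeries ℤ) = PowerSeries.C 3 from rfl,
        show (2 : PowerSeries ℤ) = PowerSeries.C 2 from rfl]
      simp only [map_add, map_sub, PowerSeries.coeff_C_mul]
      simp only [pow_two, PowerSeries.coeff_mul, PowerSeries.coeff_one, hT, PowerSeries.coeff_mk]
      have := congrArg (Nat.cast : ℕ → ℤ) (nonemptyCount_succ n)
      push_cast at this
      linarith
  rw [hsub, hH]
  linear_combination hrec

/-! ### Initial values and the truncated functional equation -/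

theorem nonemptyCount_values :
    nonemptyCount 1 = 1 ∧ nonemptyCount 2 = 3 ∧ nonemptyCount 3 = 9 ∧ nonemptyCount 4 = 39 ∧
      nonemptyCount 5 = 165 ∧ nonemptyCount 6 = 759 ∧ nonemptyCount 7 = 3549 ∧
      nonemptyCount 8 = 17067 := by
  have h0 := nonemptyCount_zero
  have h1 : nonemptyCount 1 = 1 := by
    have := nonemptyCount_succ 0
    simp [h0] at this
    omega
  have h2 : nonemptyCount 2 = 3 := by
    have := nonemptyCount_succ 1
    simp [h0, h1, Finset.Nat.antidiagonal_succ] at this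
    omega
  have h3 : nonemptyCount 3 = 9 := by
    have := nonemptyCount_succ 2
    simp [h0, h1, h2, Finset.Nat.antidiagonal_succ] at this
    omega
  have h4 : nonemptyCount 4 = 39 := by
    have := nonemptyCount_succ 3
    simp [h0, h1, h2, h3, Finset.Nat.antidiagonal_succ, Nat.even_iff] at this
    omega
  have h5 : nonemptyCount 5 = 165 := by
    have := nonemptyCount_succ 4
    simp [h0, h1, h2, h3, h4, Finset.Nat.antidiagonal_succ, Nat.even_iff] at this
    omega
  have h6 : nonemptyCount 6 = 759 := by
    have := nonemptyCount_succ 5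
    simp [h0, h1, h2, h3, h4, h5, Finset.Nat.antidiagonal_succ, Nat.even_iff] at this
    omega
  have h7 : nonemptyCount 7 = 3549 := by
    have := nonemptyCount_succ 6
    simp [h0, h1, h2, h3, h4, h5, h6, Finset.Nat.antidiagonal_succ, Nat.even_iff] at this
    omega
  have h8 : nonemptyCount 8 = 17067 := by
    have := nonemptyCount_succ 7
    simp [h0, h1, h2, h3, h4, h5, h6, h7, Finset.Nat.antidiagonal_succ, Nat.even_iff] at this
    omega
  exact ⟨h1, h2, h3, h4, h5, h6, h7, h8⟩

/-- The sum of the first `N` terms of the generating function of `nonemptyCount` at `x`. -/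
noncomputable def partialSum (N : ℕ) (x : ℝ) : ℝ :=
  ∑ n ∈ Finset.range N, (nonemptyCount n : ℝ) * x ^ n

theorem partialSum_nonneg (N : ℕ) {x : ℝ} (hx : 0 ≤ x) : 0 ≤ partialSum N x :=
  Finset.sum_nonneg fun _ _ => by positivity

theorem partialSum_mono {M N : ℕ} (h : M ≤ N) {x : ℝ} (hx : 0 ≤ x) :
    partialSum M x ≤ partialSum N x :=
  Finset.sum_le_sum_of_subset_of_nonneg (Finset.range_mono h) fun _ _ _ => by positivity

/-- The part of `partialSum N x ^ 2` of degree less than `N`. -/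
noncomputable def convolutionSum (N : ℕ) (x : ℝ) : ℝ :=
  ∑ n ∈ Finset.range N, ∑ ij ∈ antidiagonal n,
    (nonemptyCount ij.1 * x ^ ij.1) * (nonemptyCount ij.2 * x ^ ij.2)

/-- The part of degree less than `N` of the generating function of `nonemptyCount` at `x ^ 2`. -/
noncomputable def evenSum (N : ℕ) (x : ℝ) : ℝ :=
  ∑ n ∈ Finset.range N, (if Even n then (nonemptyCount (n / 2) : ℝ) else 0) * x ^ n

/-- The index set becomes the triangle i + j < N, which lies inside the square of side N and, for 2N
in place of N, contains it. This yields the two comparisons with `partialSum N x ^ 2`. -/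
theorem convolutionSum_eq (N : ℕ) (x : ℝ) :
    convolutionSum N x =
      ∑ ij ∈ (Finset.range N ×ˢ Finset.range N).filter (fun ij => ij.1 + ij.2 < N),
      (nonemptyCount ij.1 * x ^ ij.1) * (nonemptyCount ij.2 * x ^ ij.2) := by
  rw [convolutionSum, Finset.sum_sigma']
  refine Finset.sum_bij (fun s _ => s.2) ?_ ?_ ?_ fun _ _ => rfl
  · rintro ⟨n, i, j⟩ h
    simp at h ⊢
    omega
  · rintro ⟨n, i, j⟩ h ⟨n', i', j'⟩ h' heq
    simp at h h' heq
    obtain ⟨rfl, rfl⟩ := heq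
    obtain rfl : n = n' := h.2.symm.trans h'.2
    rfl
  · rintro ⟨i, j⟩ h
    exact ⟨⟨i + j, i, j⟩, by simpa using (Finset.mem_filter.1 h).2, rfl⟩

theorem convolutionSum_le (N : ℕ) {x : ℝ} (hx : 0 ≤ x) :
    convolutionSum N x ≤ partialSum N x ^ 2 := by
  rw [convolutionSum_eq, pow_two, partialSum, Finset.sum_mul_sum, ← Finset.sum_product']
  exact Finset.sum_le_sum_of_subset_of_nonneg (Finset.filter_subset _ _)
    fun _ _ _ => by positivity

theorem sq_partialSum_le (N : ℕ) {x : ℝ} (hx : 0 ≤ x) :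
    partialSum N x ^ 2 ≤ convolutionSum (2 * N) x := by
  rw [convolutionSum_eq, pow_two, partialSum, Finset.sum_mul_sum, ← Finset.sum_product']
  refine Finset.sum_le_sum_of_subset_of_nonneg ?_ fun _ _ _ => by positivity
  rintro ⟨i, j⟩ h
  simp at h ⊢
  omega

theorem partialSum_sq_le_evenSum (k : ℕ) {N : ℕ} (h : 2 * k ≤ N + 1) {x : ℝ} (hx : 0 ≤ x) :
    partialSum k (x ^ 2) ≤ evenSum N x := by
  have hinj : Function.Injective fun i : ℕ => 2 * i := fun i j h => by simpa using h
  calc partialSum k (x ^ 2)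
      = ∑ n ∈ (Finset.range k).image (fun i => 2 * i),
          (if Even n then (nonemptyCount (n / 2) : ℝ) else 0) * x ^ n := by
        rw [Finset.sum_image hinj.injOn, partialSum]
        simp [pow_mul]
    _ ≤ evenSum N x := by
        refine Finset.sum_le_sum_of_subset_of_nonneg ?_ fun _ _ _ => by positivity
        intro n
        simp
        omega

theorem evenSum_le_partialSum_sq (N : ℕ) {x : ℝ} (hx : 0 ≤ x) :
    evenSum N x ≤ partialSum N (x ^ 2) := by
  have hinj : Function.Injective fun i : ℕ => 2 * i := fun i j h => by simpa using h
  calc evenSum N x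
      ≤ ∑ n ∈ (Finset.range N).image (fun i => 2 * i),
          (if Even n then (nonemptyCount (n / 2) : ℝ) else 0) * x ^ n := by
        rw [evenSum, ← Finset.sum_filter_add_sum_filter_not (Finset.range N) Even,
          Finset.sum_eq_zero (s := (Finset.range N).filter fun n => ¬ Even n), add_zero]
        · refine Finset.sum_le_sum_of_subset_of_nonneg ?_ fun _ _ _ => by positivity
          intro n hn
          simp only [Finset.mem_filter, Finset.mem_range, Finset.mem_image] at hn ⊢
          obtain ⟨h, m, rfl⟩ := hn
          exact ⟨m, by omega, by omega⟩
        · intro n hn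
          simp [(Finset.mem_filter.1 hn).2]
    _ = partialSum N (x ^ 2) := by
        rw [Finset.sum_image hinj.injOn, partialSum]
        simp [pow_mul]

/-- An exact finite form of the equation for T, so no convergence is needed. `N ≠ 0` keeps the
constant term 1 in range. -/
theorem partialSum_succ {N : ℕ} (hN : N ≠ 0) (x : ℝ) :
    partialSum (N + 1) x =
      x * (1 + 3 * partialSum N x + 2 * convolutionSum N x - 2 * evenSum N x) := by
  have h1 : ∑ n ∈ Finset.range N, (if n = 0 then (1 : ℝ) else 0) * x ^ n = 1 := by
    rw [Finset.sum_eq_single_of_mem 0 (by simp; omega) (by simp +contextual)]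
    simp
  rw [partialSum, Finset.sum_range_succ', nonemptyCount_zero, Nat.cast_zero, zero_mul, add_zero]
  nth_rw 1 [← h1]
  rw [partialSum, convolutionSum, evenSum]
  simp only [Finset.mul_sum, ← Finset.sum_add_distrib, ← Finset.sum_sub_distrib]
  refine Finset.sum_congr rfl fun n _ => ?_
  have hn := congrArg (Nat.cast : ℕ → ℝ) (nonemptyCount_succ n)
  push_cast at hn
  have hs : ∑ ij ∈ antidiagonal n,
      2 * ((nonemptyCount ij.1 * x ^ ij.1) * (nonemptyCount ij.2 * x ^ ij.2)) =
      2 * (∑ ij ∈ antidiagonal n,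
        (nonemptyCount ij.1 * nonemptyCount ij.2 : ℝ)) * x ^ n := by
    rw [Finset.mul_sum, Finset.sum_mul]
    refine Finset.sum_congr rfl fun ij hij => ?_
    rw [← mem_antidiagonal.1 hij, pow_add]
    ring
  rw [hs, pow_succ]
  linear_combination x ^ n * x * hn

/-! ### Upper bound on the counts -/

/-- The partial sums at `1 / 5.732051` are bounded. -/
theorem partialSum_le (N : ℕ) : partialSum N (1 / 5.732051) ≤ 2.732051 / 4 := by
  have hx : (0 : ℝ) ≤ 1 / 5.732051 := by norm_num
  obtain ⟨h1, h2, h3, h4, h5, h6, h7, h8⟩ := nonemptyCount_values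
  have h9 : partialSum 9 (1 / 5.732051) ≤ 2.732051 / 4 := by
    norm_num [partialSum, Finset.sum_range_succ, nonemptyCount_zero, h1, h2, h3, h4, h5, h6, h7, h8]
  rcases le_total N 9 with h | h
  -- Induction starts at 9 because five terms of T(x²) have degree up to 8 in x.
  · exact (partialSum_mono h hx).trans h9
  induction N, h using Nat.le_induction with
  | base => exact h9
  | succ N hN ih =>
    have hc := convolutionSum_le N hx
    have hp := partialSum_nonneg N hx
    have he := partialSum_sq_le_evenSum 5 (N := N) (by omega) hx
    have hs : partialSum N (1 / 5.732051) ^ 2 ≤ (2.732051 / 4) ^ 2 := by gcongr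
    -- The bound 2.732051/4 = (κ - 3)/4 is preserved because 2.732051² ≥ 8(1 - 2 · 0.0335).
    have h5 : (0.0335 : ℝ) ≤ partialSum 5 ((1 / 5.732051) ^ 2) := by
      norm_num [partialSum, Finset.sum_range_succ, nonemptyCount_zero, h1, h2, h3, h4]
    rw [partialSum_succ (by omega), one_div_mul_eq_div, div_le_iff₀ (by norm_num)]
    linarith

theorem nonemptyCount_le (n : ℕ) : (nonemptyCount n : ℝ) ≤ 2.732051 / 4 * 5.732051 ^ n := by
  have h := partialSum_le (n + 1)
  rw [partialSum, Finset.sum_range_succ] at h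
  have h0 : 0 ≤ ∑ i ∈ Finset.range n, (nonemptyCount i : ℝ) * (1 / 5.732051) ^ i :=
    Finset.sum_nonneg fun _ _ => by positivity
  rw [one_div_pow, mul_one_div] at h
  exact (div_le_iff₀ (by positivity)).1 (by linarith)

theorem hipsterCount_le (n : ℕ) : (hipsterCount n : ℝ) ≤ 5.732051 ^ n := by
  rcases n with _ | n
  · simp [hipsterCount_zero]
  · rw [hipsterCount_eq, if_neg n.succ_ne_zero, zero_add]
    refine (nonemptyCount_le _).trans ?_
    have : (0 : ℝ) ≤ 5.732051 ^ (n + 1) := by positivity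
    linarith

/-! ### Divergence at 1/5.731821 and the bounds on the limit -/

/-- Six terms are computed exactly; the upper bound `nonemptyCount_le` dominates the tail by a
geometric series. -/
theorem partialSum_sq_le (N : ℕ) : partialSum N ((1 / 5.731821) ^ 2) ≤ 0.03355 := by
  have hx : (0 : ℝ) ≤ (1 / 5.731821) ^ 2 := by norm_num
  obtain ⟨h1, h2, h3, h4, h5, -⟩ := nonemptyCount_values
  refine (partialSum_mono (Nat.le_add_left N 6) hx).trans ?_
  have hr : ∀ n, ((nonemptyCount n : ℝ) * ((1 / 5.731821) ^ 2) ^ n) ≤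
      2.732051 / 4 * (5.732051 / 5.731821 ^ 2) ^ n := fun n => by
    rw [div_eq_mul_one_div 5.732051, mul_pow, ← mul_assoc, ← one_div_pow]
    gcongr
    exact nonemptyCount_le n
  have hg : ∑ n ∈ Finset.range N, (5.732051 / 5.731821 ^ 2 : ℝ) ^ n ≤
      (1 - 5.732051 / 5.731821 ^ 2)⁻¹ := by
    rw [← tsum_geometric_of_lt_one (by norm_num) (by norm_num)]
    exact (summable_geometric_of_lt_one (by norm_num) (by norm_num)).sum_le_tsum _
      fun _ _ => by positivity
  rw [partialSum, Finset.sum_range_add]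
  calc _ ≤ ∑ n ∈ Finset.range 6, (nonemptyCount n : ℝ) * ((1 / 5.731821) ^ 2) ^ n +
        ∑ n ∈ Finset.range N, 2.732051 / 4 * (5.732051 / 5.731821 ^ 2) ^ (6 + n) := by
        exact add_le_add le_rfl (Finset.sum_le_sum fun n _ => hr (6 + n))
    _ = ∑ n ∈ Finset.range 6, (nonemptyCount n : ℝ) * ((1 / 5.731821) ^ 2) ^ n +
        2.732051 / 4 * (5.732051 / 5.731821 ^ 2) ^ 6 *
          ∑ n ∈ Finset.range N, (5.732051 / 5.731821 ^ 2) ^ n := by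
        rw [Finset.mul_sum]
        simp only [pow_add, mul_assoc]
    _ ≤ ∑ n ∈ Finset.range 6, (nonemptyCount n : ℝ) * ((1 / 5.731821) ^ 2) ^ n +
        2.732051 / 4 * (5.732051 / 5.731821 ^ 2) ^ 6 * (1 - 5.732051 / 5.731821 ^ 2)⁻¹ := by
        gcongr
    _ ≤ 0.03355 := by
        norm_num [Finset.sum_range_succ, nonemptyCount_zero, h1, h2, h3, h4, h5]

/-- As 2.731821² < 8(1 - 2 · 0.03355), the quadratic has no real root. Completing the square at
2.731821/4 leaves a positive gap, so passing from N to 2N + 1 adds a fixed amount. -/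
theorem partialSum_add_le {N : ℕ} (hN : N ≠ 0) :
    partialSum N (1 / 5.731821) + 1e-7 ≤ partialSum (2 * N + 1) (1 / 5.731821) := by
  have hx : (0 : ℝ) ≤ 1 / 5.731821 := by norm_num
  have hs := sq_partialSum_le N hx
  have hm := partialSum_mono (show N ≤ 2 * N by omega) hx
  have he := (evenSum_le_partialSum_sq (2 * N) hx).trans (partialSum_sq_le _)
  rw [partialSum_succ (by omega), one_div_mul_eq_div, le_div_iff₀ (by norm_num)]
  nlinarith [sq_nonneg (partialSum N (1 / 5.731821) - 2.731821 / 4)]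

theorem exists_lt_partialSum (B : ℝ) : ∃ N, B < partialSum N (1 / 5.731821) := by
  have h : ∀ k : ℕ, ∃ N, N ≠ 0 ∧ k * 1e-7 ≤ partialSum N (1 / 5.731821) := by
    intro k
    induction k with
    | zero => exact ⟨1, one_ne_zero, by simpa using partialSum_nonneg 1 (by norm_num)⟩
    | succ k ih =>
      obtain ⟨N, hN, h⟩ := ih
      refine ⟨2 * N + 1, by omega, le_trans ?_ (partialSum_add_le hN)⟩
      push_cast
      linarith
  obtain ⟨k, hk⟩ := exists_nat_gt (B / 1e-7)
  obtain ⟨N, -, hN⟩ := h k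
  exact ⟨N, lt_of_lt_of_le ((div_lt_iff₀ (by norm_num)).1 hk) hN⟩

theorem le_of_hasGrowthRate {K : ℝ} (hK : HasGrowthRate hipsterCount K) : 5.731821 ≤ K := by
  by_contra! hlt
  have hK0 : 0 ≤ K := ge_of_tendsto' hK fun n => by positivity
  obtain ⟨L, hL1, hL2⟩ := exists_between hlt
  have hL0 : 0 < L := hK0.trans_lt hL1
  -- A growth rate below L < 5.731821 would make the series converge at 1/5.731821.
  have hev : ∀ᶠ n : ℕ in atTop,
      ‖(nonemptyCount n : ℝ) * (1 / 5.731821) ^ n‖ ≤ (L / 5.731821) ^ n := by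
    filter_upwards [hK.eventually_lt_const hL1, eventually_ne_atTop 0] with n hn hn0
    have h1 : (hipsterCount n : ℝ) ≤ L ^ n := by
      have := pow_le_pow_left₀ (by positivity) hn.le n
      rwa [one_div, Real.rpow_inv_natCast_pow (by positivity) hn0] at this
    rw [hipsterCount_eq, if_neg hn0, zero_add] at h1
    rw [Real.norm_of_nonneg (by positivity), div_pow, div_pow, one_pow, mul_one_div]
    gcongr
  have hsum : Summable fun n : ℕ => (nonemptyCount n : ℝ) * (1 / 5.731821) ^ n :=
    Summable.of_norm_bounded_eventually_nat
      (summable_geometric_of_lt_one (by positivity) ((div_lt_one (by norm_num)).2 hL2)) hev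
  obtain ⟨N, hN⟩ := exists_lt_partialSum
    (∑' n : ℕ, (nonemptyCount n : ℝ) * (1 / 5.731821) ^ n)
  exact hN.not_ge (hsum.sum_le_tsum _ fun _ _ => by positivity)

theorem hasGrowthRate_le {K : ℝ} (hK : HasGrowthRate hipsterCount K) : K ≤ 5.732051 := by
  refine le_of_tendsto hK ?_
  filter_upwards [eventually_ne_atTop 0] with n hn
  calc (hipsterCount n : ℝ) ^ (1 / (n : ℝ)) ≤ ((5.732051 : ℝ) ^ n) ^ (1 / (n : ℝ)) := by
        gcongr
        exact hipsterCount_le n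
    _ = 5.732051 := by
        rw [one_div, Real.pow_rpow_inv_natCast (by norm_num) hn]

/-! ### Existence of the growth rate -/

theorem hipsterCount_le_succ (n : ℕ) : hipsterCount n ≤ hipsterCount (n + 1) := by
  have h := nonemptyCount_succ n
  rw [hipsterCount_eq, hipsterCount_eq, if_neg n.succ_ne_zero]
  have hd : (if Even n then nonemptyCount (n / 2) else 0) ≤
      ∑ ij ∈ antidiagonal n, nonemptyCount ij.1 * nonemptyCount ij.2 := by
    split_ifs with he
    · obtain ⟨m, rfl⟩ := he
      refine le_trans ?_ (Finset.single_le_sum (a := (m, m)) (fun _ _ => Nat.zero_le _)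
        (mem_antidiagonal.2 rfl))
      rw [show (m + m) / 2 = m by omega]
      exact Nat.le_mul_self _
    · exact Nat.zero_le _
  omega

theorem hipsterCount_pos (n : ℕ) : 0 < hipsterCount n :=
  (hipsterCount_zero.symm ▸ one_pos : 0 < hipsterCount 0).trans_le
    (monotone_nat_of_le_succ hipsterCount_le_succ (Nat.zero_le n))

/-- Trees of sizes m ≠ n are joined under a new root. If m = n, equal pairs are lost, but two colors
and the one-child trees compensate: 2g² - 2g + 3 ≥ g² for g = `nonemptyCount m`. -/
theorem hipsterCount_mul_le (m n : ℕ) :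
    hipsterCount m * hipsterCount n ≤ hipsterCount (m + n + 1) := by
  rcases Nat.eq_zero_or_pos m with rfl | hm
  · simpa [hipsterCount_zero] using hipsterCount_le_succ n
  rcases Nat.eq_zero_or_pos n with rfl | hn
  · simpa [hipsterCount_zero] using hipsterCount_le_succ m
  have hpos := hipsterCount_pos (m + n)
  simp only [hipsterCount_eq, if_neg hm.ne', if_neg hn.ne', if_neg (show m + n ≠ 0 by omega),
    if_neg (m + n).succ_ne_zero, zero_add] at hpos ⊢
  have h := nonemptyCount_succ (m + n)
  rw [if_neg (show m + n ≠ 0 by omega)] at h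
  set g := nonemptyCount
  by_cases hmn : m = n
  · subst hmn
    have h1 := Finset.single_le_sum (f := fun ij : ℕ × ℕ => g ij.1 * g ij.2) (a := (m, m))
      (fun _ _ => Nat.zero_le _) (mem_antidiagonal.2 rfl)
    rw [if_pos ⟨m, rfl⟩, show (m + m) / 2 = m by omega] at h
    dsimp only at h1
    nlinarith [sq_nonneg ((g m : ℤ) - 1)]
  · have h1 : g m * g n + (if Even (m + n) then g ((m + n) / 2) else 0) ≤
        ∑ ij ∈ antidiagonal (m + n), g ij.1 * g ij.2 := by
      split_ifs with he
      · obtain ⟨k, hk⟩ := he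
        have hne : (m, n) ≠ (k, k) := by
          intro h
          simp at h
          omega
        have hsub : {(m, n), (k, k)} ⊆ antidiagonal (m + n) := by
          intro p hp
          simp only [Finset.mem_insert, Finset.mem_singleton] at hp
          rw [mem_antidiagonal]
          rcases hp with rfl | rfl
          · rfl
          · exact hk.symm
        have := Finset.sum_le_sum_of_subset (f := fun ij : ℕ × ℕ => g ij.1 * g ij.2) hsub
        rw [Finset.sum_pair hne] at this
        rw [show (m + n) / 2 = k by omega]
        have := Nat.le_mul_self (g k)
        dsimp only at *
        omega
      · exact Finset.single_le_sum (f := fun ij : ℕ × ℕ => g ij.1 * g ij.2) (a := (m, n))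
          (fun _ _ => Nat.zero_le _) (mem_antidiagonal.2 rfl)
    omega

theorem exists_hasGrowthRate : ∃ K, HasGrowthRate hipsterCount K := by
  -- The index shift absorbs the +1 in `hipsterCount_mul_le`; truncated subtraction gives `u 0 =
  -- -log 1 = 0`.
  set u : ℕ → ℝ := fun n => -Real.log (hipsterCount (n - 1)) with hu
  have hpos : ∀ n, (0 : ℝ) < hipsterCount n := fun n => by exact_mod_cast hipsterCount_pos n
  have hsub : Subadditive u := by
    intro m n
    rcases m with _ | m
    · simp [hu, hipsterCount_zero]
    rcases n with _ | n
    · simp [hu, hipsterCount_zero]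
    have h : (hipsterCount m * hipsterCount n : ℝ) ≤ hipsterCount (m + n + 1) := by
      exact_mod_cast hipsterCount_mul_le m n
    have := Real.log_le_log (mul_pos (hpos m) (hpos n)) h
    rw [Real.log_mul (hpos m).ne' (hpos n).ne'] at this
    simp only [hu, Nat.add_sub_cancel, show m + 1 + (n + 1) - 1 = m + n + 1 by omega]
    linarith
  have hbdd : BddBelow (Set.range fun n => u n / n) := by
    refine ⟨-Real.log 5.732051, ?_⟩
    rintro _ ⟨n, rfl⟩
    rcases n with _ | n
    · simpa using Real.log_nonneg (by norm_num)
    have h : (hipsterCount n : ℝ) ≤ 5.732051 ^ (n + 1) :=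
      (hipsterCount_le n).trans (pow_le_pow_right₀ (by norm_num) n.le_succ)
    have := Real.log_le_log (hpos n) h
    rw [Real.log_pow] at this
    simp only [hu, Nat.add_sub_cancel]
    rw [le_div_iff₀ (by positivity)]
    linarith
  have h1 := (hsub.tendsto_lim hbdd).comp (tendsto_add_atTop_nat 1)
  have h2 : Tendsto (fun n : ℕ => 1 + 1 / (n : ℝ)) atTop (𝓝 1) := by
    simpa using tendsto_const_nhds.add (tendsto_one_div_atTop_nhds_zero_nat (𝕜 := ℝ))
  refine ⟨Real.exp (-hsub.lim), ?_⟩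
  -- The factor 1 + 1/n turns u(n+1)/(n+1) into u(n+1)/n = -log(h_n)/n.
  have h3 := ((Real.continuous_exp.tendsto _).comp (h1.mul h2).neg)
  rw [mul_one] at h3
  refine h3.congr' ?_
  filter_upwards [eventually_ne_atTop 0] with n hn
  rw [Real.rpow_def_of_pos (hpos n)]
  simp only [hu, Function.comp_apply, Nat.add_sub_cancel]
  congr 1
  have : (n : ℝ) ≠ 0 := by exact_mod_cast hn
  push_cast
  field_simp

end HipsterTree

theorem mainTheorem3 :
    (∀ n : ℕ, HipsterTree.treeCount n = Nat.smallSchroder (n + 1)) ∧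
    HipsterTree.hipsterSeries =
      PowerSeries.X *
        (2 * HipsterTree.hipsterSeries ^ 2 - HipsterTree.hipsterSeries
          - 2 * HipsterTree.hipsterSeries.subst (PowerSeries.X ^ 2 : PowerSeries ℤ) + 2) + 1 ∧
    ∃ K : ℝ, HipsterTree.HasGrowthRate HipsterTree.hipsterCount K ∧
      K ∈ Set.Icc (5.731821 : ℝ) 5.732051 := by
  obtain ⟨K, hK⟩ := HipsterTree.exists_hasGrowthRate
  exact ⟨HipsterTree.treeCount_eq, HipsterTree.hipsterSeries_eq, K, hK,
    HipsterTree.le_of_hasGrowthRate hK, HipsterTree.hasGrowthRate_le hK⟩
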